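/- Let $K$ be a Noetherian commutative ring and let $k,d\ge 0$ be integers. Let $X=\operatorname{Spec} K[x_{i,j} : i\in\{1,\dots,k\},\, j\in\mathbb N]$ be the $K$-scheme of $k\times\mathbb N$-matrices and $Y=\operatorname{Spec} K[y_{i_1,\dots,i_d} : i_1,\dots,i_d\in\mathbb N]$ the $K$-scheme of $\mathbb N\times\cdots\times\mathbb N$-tensors ($d$ factors). The group $\operatorname{Sym}(\mathbb N)$ of permutations of $\mathbb N$ acts on the coordinate rings by $K$-algebra automorphisms with $\sigma x_{i,j}=x_{i,\sigma(j)}$ and $\sigma y_{i_1,\dots,i_d}=y_{\sigma(i_1),\dots,\sigma(i_d)}$, and correspondingly on $X$ and $Y$. Let $\varphi:X\to Y$ be a $\operatorname{Sym}(\mathbb N)$-equivariant morphism of $K$-schemes, and let $\overline{\operatorname{Im}(\varphi)}\subseteq Y$ be the Zariski closure of its image. Then: 1. $\overline{\operatorname{Im}(\varphi)}$ is defined set-theoretically by finitely many $\operatorname{Sym}(\mathbb N)$-orbits of equations: there is a finite set $F\subseteq K[y_{i_1,\dots,i_d} : i_1,\dots,i_d\in\mathbb N]$ such that $\overline{\operatorname{Im}(\varphi)}$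 is the set of points of $Y$ at which all $\sigma f$ with $f\in F$ and $\sigma\in\operatorname{Sym}(\mathbb N)$ vanish. 2. $\overline{\operatorname{Im}(\varphi)}$ is topologically $\operatorname{Sym}(\mathbb N)$-Noetherian: every descending chain $\overline{\operatorname{Im}(\varphi)}\supseteq X_1\supseteq X_2\supseteq\cdots$ of $\operatorname{Sym}(\mathbb N)$-stable closed subsets of $Y$ (equivalently, of $\operatorname{Sym}(\mathbb N)$-stable reduced closed subschemes) stabilises. -/

import Mathlib

open CategoryTheory AlgebraicGeometry

universe u

noncomputable section

/-- The left action of `Sym(ℕ)` on the polynomial ring `K[x_{i,j} : i ∈ [k], j ∈ ℕ]`,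
with `σ • x_{i,j} = x_{i,σ(j)}`. -/
def matrixRingAct (K : Type u) [CommRing K] (k : ℕ) (σ : Equiv.Perm ℕ) :
    MvPolynomial (Fin k × ℕ) K →ₐ[K] MvPolynomial (Fin k × ℕ) K :=
  MvPolynomial.rename (fun p => (p.1, σ p.2))

/-- The left action of `Sym(ℕ)` on the polynomial ring `K[y_{i_1,…,i_d} : i_1,…,i_d ∈ ℕ]`,
with `σ • y_{i_1,…,i_d} = y_{σ(i_1),…,σ(i_d)}`. -/
def tensorRingAct (K : Type u) [CommRing K] (d : ℕ) (σ : Equiv.Perm ℕ) :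
    MvPolynomial (Fin d → ℕ) K →ₐ[K] MvPolynomial (Fin d → ℕ) K :=
  MvPolynomial.rename (fun i => fun l => σ (i l))

/-- The `K`-scheme of `k × ℕ`-matrices. -/
abbrev matrixScheme (K : Type u) [CommRing K] (k : ℕ) : Over (Spec (CommRingCat.of K)) :=
  Over.mk (Spec.map (CommRingCat.ofHom (algebraMap K (MvPolynomial (Fin k × ℕ) K))))

/-- The `K`-scheme of `ℕ × ⋯ × ℕ`-tensors, with `d` factors. -/
abbrev tensorScheme (K : Type u) [CommRing K] (d : ℕ) : Over (Spec (CommRingCat.of K)) :=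
  Over.mk (Spec.map (CommRingCat.ofHom (algebraMap K (MvPolynomial (Fin d → ℕ) K))))

/-- The left action of `Sym(ℕ)` on the scheme of `k × ℕ`-matrices by permuting columns:
on coordinates, `(σ • M)_{i,j} = M_{i,σ⁻¹(j)}`. -/
def matrixAct (K : Type u) [CommRing K] (k : ℕ) (σ : Equiv.Perm ℕ) :
    matrixScheme K k ⟶ matrixScheme K k :=
  Over.homMk (Spec.map (CommRingCat.ofHom (matrixRingAct K k σ⁻¹).toRingHom)) (by
    dsimp only [Over.mk_left, Over.mk_hom]
    rw [← Spec.map_comp, ← CommRingCat.ofHom_comp]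
    congr 2
    exact (matrixRingAct K k σ⁻¹).comp_algebraMap)

/-- The left (diagonal) action of `Sym(ℕ)` on the scheme of `ℕ × ⋯ × ℕ`-tensors:
on coordinates, `(σ • T)_{i_1,…,i_d} = T_{σ⁻¹(i_1),…,σ⁻¹(i_d)}`. -/
def tensorAct (K : Type u) [CommRing K] (d : ℕ) (σ : Equiv.Perm ℕ) :
    tensorScheme K d ⟶ tensorScheme K d :=
  Over.homMk (Spec.map (CommRingCat.ofHom (tensorRingAct K d σ⁻¹).toRingHom)) (by
    dsimp only [Over.mk_left, Over.mk_hom]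
    rw [← Spec.map_comp, ← CommRingCat.ofHom_comp]
    congr 2
    exact (tensorRingAct K d σ⁻¹).comp_algebraMap)

/-- A morphism of `K`-schemes from matrices to tensors is `Sym(ℕ)`-equivariant. -/
def IsSymEquivariant {K : Type u} [CommRing K] {k d : ℕ}
    (φ : matrixScheme K k ⟶ tensorScheme K d) : Prop :=
  ∀ σ : Equiv.Perm ℕ, matrixAct K k σ ≫ φ = φ ≫ tensorAct K d σ

/-- The closure, in the Zariski topology, of the image of a morphism. -/
def imageClosure {K : Type u} [CommRing K] {k d : ℕ}
    (φ : matrixScheme K k ⟶ tensorScheme K d) : Set (tensorScheme K d).left :=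
  closure (Set.range φ.left)

/-- The `Sym(ℕ)`-orbit of a polynomial in the tensor coordinates. -/
def symOrbit {K : Type u} [CommRing K] {d : ℕ} (f : MvPolynomial (Fin d → ℕ) K) :
    Set (MvPolynomial (Fin d → ℕ) K) :=
  Set.range (fun σ : Equiv.Perm ℕ => tensorRingAct K d σ f)

/-- The closed set of points of the tensor scheme at which all members of `E` vanish. -/
def commonZeros {K : Type u} [CommRing K] {d : ℕ} (E : Set (MvPolynomial (Fin d → ℕ) K)) :
    Set (tensorScheme K d).left :=
  PrimeSpectrum.zeroLocus E

/-- A set of points of the tensor scheme is mapped into itself by every element of `Sym(ℕ)`. -/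
def IsSymStable {K : Type u} [CommRing K] {d : ℕ} (Z : Set (tensorScheme K d).left) : Prop :=
  ∀ σ : Equiv.Perm ℕ, Set.MapsTo (tensorAct K d σ).left Z Z

/-- Descending chains of `Sym(ℕ)`-stable closed subsets of the tensor scheme that are contained
in `Z` stabilise. -/
def IsTopSymNoetherian {K : Type u} [CommRing K] {d : ℕ}
    (Z : Set (tensorScheme K d).left) : Prop :=
  ∀ X : ℕ → Set (tensorScheme K d).left,
    (∀ n, IsClosed (X n)) → (∀ n, IsSymStable (X n)) → (∀ n, X n ⊆ Z) → Antitone X →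
      ∃ N, ∀ n, N ≤ n → X n = X N

end

/-! Flatten the generic tensor along a set `A` of positions: rows are indexed by one number placed
at all positions of `A`, columns by the remaining entries. By equivariance the image of a coordinate
involves only the columns of the matrix named by its indices, and its degree is bounded because
there are finitely many orbits of coordinates. Each flattening therefore factors through `(D + 1) ^
k` monomials in the column of the row index, so large admissible minors lie in the kernel
(`exists_minors_mem_ker`) and the image closure lies in a `rankLocus`.

It remains to show that rank loci are Noetherian up to symmetry (`stabilizesOn_rankLocus`), by
induction on the sum of the minor sizes. At a point of the locus, either the nonvanishing minors of
the next smaller size for some `A` have rows meeting a small set, and moving that set below a larger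
threshold `n` lowers a rank; or every `A` has `d + 1` row-disjoint nonvanishing minors. In the
second case bordered minors express every coordinate, after inverting those minors, through
coordinates with at most one large index. These are finitely many sequences of variables, so Cohen's
theorem (`symStable_ideal_chain_stabilizes`) applies. Finitely many such pieces cover the locus up
to permutations.

Both claims follow: the rank locus is itself cut out by finitely many orbits of minors, and inside
it finitely many further orbits suffice. -/

section LeadingCoefficients

/-! ### Leading coefficient ideals in the colexicographic order. -/

variable {K : Type*} [CommRing K] {T : Type*} [LinearOrder T]

/-- The ideal of coefficients at the exponent `m` of those elements of `I` all of whose exponents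
are at most `m` in the colexicographic order. -/
def leadingCoeffIdeal (I : Ideal (MvPolynomial T K)) (m : T →₀ ℕ) : Ideal K where
  carrier := {c | ∃ f ∈ I, (∀ u, toColex m < toColex u → f.coeff u = 0) ∧ f.coeff m = c}
  zero_mem' := ⟨0, I.zero_mem, by simp, by simp⟩
  add_mem' := by
    rintro _ _ ⟨f, hf, hf', rfl⟩ ⟨g, hg, hg', rfl⟩
    refine ⟨f + g, I.add_mem hf hg, fun u hu => ?_, by simp⟩
    rw [MvPolynomial.coeff_add, hf' u hu, hg' u hu, add_zero]
  smul_mem' := by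
    rintro a _ ⟨f, hf, hf', rfl⟩
    refine ⟨MvPolynomial.C a * f, I.mul_mem_left _ hf, fun u hu => ?_, by simp⟩
    rw [MvPolynomial.coeff_C_mul, hf' u hu, mul_zero]

lemma leadingCoeffIdeal_mono {I J : Ideal (MvPolynomial T K)} (h : I ≤ J) (m : T →₀ ℕ) :
    leadingCoeffIdeal I m ≤ leadingCoeffIdeal J m := by
  rintro _ ⟨f, hf, hf'⟩
  exact ⟨f, h hf, hf'⟩

/-- Subtracting an element of `I` with the same leading term lowers the leading exponent, and the
colexicographic order is well-founded. -/
lemma eq_of_leadingCoeffIdeal_eq [WellFoundedLT T] {I J : Ideal (MvPolynomial T K)} (h : I ≤ J)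
    (hm : ∀ m, leadingCoeffIdeal I m = leadingCoeffIdeal J m) : I = J := by
  have key : ∀ c : Colex (T →₀ ℕ), ∀ f ∈ J, (∀ u, c < toColex u → f.coeff u = 0) → f ∈ I := by
    intro c
    induction c using WellFoundedLT.induction with
    | ind c ih =>
      intro f hf hfc
      have : f.coeff (ofColex c) ∈ leadingCoeffIdeal J (ofColex c) :=
        ⟨f, hf, by simpa using hfc, rfl⟩
      rw [← hm] at this
      obtain ⟨g, hg, hgc, hgf⟩ := this
      suffices hfg : f - g ∈ I by simpa using I.add_mem hfg hg
      have hsub : ∀ u, c ≤ toColex u → (f - g).coeff u = 0 := by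
        intro u hu
        rw [MvPolynomial.coeff_sub]
        rcases hu.eq_or_lt with hu | hu
        · have : g.coeff u = f.coeff u := by
            rw [show u = ofColex c by rw [hu]; rfl]; exact hgf
          rw [this, sub_self]
        · rw [hfc u hu, hgc u (by simpa using hu), sub_zero]
      by_cases h0 : f - g = 0
      · rw [h0]; exact I.zero_mem
      obtain ⟨b, hb, hmax⟩ := (f - g).support.exists_max_image toColex
        (MvPolynomial.support_nonempty.2 h0)
      refine ih (toColex b) ?_ (f - g) (J.sub_mem hf (h hg)) fun u hu => ?_
      · by_contra hcb
        exact MvPolynomial.mem_support_iff.1 hb (hsub b (not_lt.1 hcb))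
      · by_contra hu'
        exact absurd (hmax u (MvPolynomial.mem_support_iff.2 hu')) (not_le.2 hu)
  refine le_antisymm h fun f hf => ?_
  by_cases h0 : f = 0
  · rw [h0]; exact I.zero_mem
  obtain ⟨b, hb, hmax⟩ := f.support.exists_max_image toColex (MvPolynomial.support_nonempty.2 h0)
  refine key (toColex b) f hf fun u hu => ?_
  by_contra hu'
  exact absurd (hmax u (MvPolynomial.mem_support_iff.2 hu')) (not_le.2 hu)

lemma toColex_mapDomain_lt (π : T ↪o T) {u v : T →₀ ℕ} (h : toColex u < toColex v) :
    toColex (u.mapDomain π) < toColex (v.mapDomain π) := by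
  obtain ⟨i, hi, hlt⟩ := Finsupp.Colex.lt_iff.1 h
  refine Finsupp.Colex.lt_iff.2 ⟨π i, fun j hj => ?_, ?_⟩
  · change u.mapDomain π j = v.mapDomain π j
    by_cases hr : j ∈ Set.range π
    · obtain ⟨j, rfl⟩ := hr
      rw [Finsupp.mapDomain_apply π.injective, Finsupp.mapDomain_apply π.injective]
      exact hi j (π.lt_iff_lt.1 hj)
    · rw [Finsupp.mapDomain_of_notMem_range _ _ hr, Finsupp.mapDomain_of_notMem_range _ _ hr]
  · change u.mapDomain π (π i) < v.mapDomain π (π i)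
    rw [Finsupp.mapDomain_apply π.injective, Finsupp.mapDomain_apply π.injective]
    exact hlt

/-- An increasing renaming followed by multiplication by a monomial preserves the order of
exponents, hence carries leading terms to leading terms. -/
lemma leadingCoeffIdeal_le_of_rename {I : Ideal (MvPolynomial T K)} (π : T ↪o T)
    (hI : ∀ f ∈ I, MvPolynomial.rename π f ∈ I) (m a : T →₀ ℕ) :
    leadingCoeffIdeal I m ≤ leadingCoeffIdeal I (a + m.mapDomain π) := by
  rintro _ ⟨f, hf, hf', rfl⟩
  refine ⟨MvPolynomial.monomial a 1 * MvPolynomial.rename π f, I.mul_mem_left _ (hI f hf),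
    fun u hu => ?_, ?_⟩
  · by_contra hne
    rw [MvPolynomial.coeff_monomial_mul'] at hne
    split_ifs at hne with hau
    · rw [one_mul] at hne
      obtain ⟨w, hw, hwf⟩ := MvPolynomial.coeff_rename_ne_zero _ _ _ hne
      have hu' : u = a + w.mapDomain π := by rw [hw, add_tsub_cancel_of_le hau]
      refine hwf (hf' w ?_)
      by_contra hle
      have hle : toColex w ≤ toColex m := not_lt.1 hle
      have : toColex (w.mapDomain π) ≤ toColex (m.mapDomain π) := by
        rcases hle.eq_or_lt with h | h
        · rw [toColex.injective h]
        · exact (toColex_mapDomain_lt π h).le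
      rw [hu'] at hu
      exact absurd hu (not_lt.2 (add_le_add_right this (toColex a)))
    · exact hne rfl
  · rw [MvPolynomial.coeff_monomial_mul, one_mul, MvPolynomial.coeff_rename_mapDomain _ π.injective]

end LeadingCoefficients

/-! ### Higman's lemma and Cohen's theorem. -/

/-- Divisibility of exponents up to a strictly increasing relabelling of the columns. -/
def ColumnEmbeds {ι : Type*} (u v : ℕ → ι → ℕ) : Prop :=
  ∃ π : ℕ ↪o ℕ, ∀ n, u n ≤ v (π n)

/-- Higman's lemma for the finite words of columns, with letters in `ι → ℕ`, which is
well-quasi-ordered by Dickson's lemma. -/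
lemma exists_monotone_subseq_columnEmbeds {ι : Type*} [Finite ι] (u : ℕ → ℕ → ι → ℕ)
    (hu : ∀ t, ∃ N, ∀ n, N ≤ n → u t n = 0) :
    ∃ g : ℕ ↪o ℕ, ∀ s t, s ≤ t → ColumnEmbeds (u (g s)) (u (g t)) := by
  choose N hN using hu
  have hp := Set.PartiallyWellOrderedOn.partiallyWellOrderedOn_sublistForall₂
    (r := ((· ≤ ·) : (ι → ℕ) → (ι → ℕ) → Prop)) (s := Set.univ)
    (Set.isPWO_of_wellQuasiOrderedLE _)
  have : IsPreorder (List (ι → ℕ)) (List.SublistForall₂ (· ≤ ·)) := { }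
  obtain ⟨g, hg⟩ := hp.exists_monotone_subseq (f := fun t => (List.range (N t)).map (u t))
    (fun _ _ _ => Set.mem_univ _)
  refine ⟨g, fun s t hst => ?_⟩
  obtain ⟨l, hl, hsub⟩ := List.sublistForall₂_iff.1 (hg s t hst)
  obtain ⟨π, hπ⟩ := List.sublist_iff_exists_orderEmbedding_getElem?_eq.1 hsub
  refine ⟨π, fun n => ?_⟩
  by_cases hn : N (g s) ≤ n
  · rw [hN _ n hn]; exact zero_le
  have hlen : l.length = N (g s) := by simpa using hl.length_eq.symm
  have hn' : n < l.length := by omega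
  have h1 : u (g s) n ≤ l[n] := by
    have := List.forall₂_iff_get.1 hl
    simpa using this.2 n (by simpa using not_le.1 hn) hn'
  refine h1.trans ?_
  have h2 := hπ n
  rw [List.getElem?_eq_getElem hn'] at h2
  obtain ⟨hlt, h3⟩ := List.getElem?_eq_some_iff.1 h2.symm
  rw [← h3]
  simp

lemma exists_perm_extending {π : ℕ → ℕ} (hπ : Function.Injective π) (s : Finset ℕ) :
    ∃ σ : Equiv.Perm ℕ, ∀ n ∈ s, σ n = π n := by
  obtain ⟨σ, hσ⟩ := Equiv.Perm.exists_extending_pair (fun n : s => (n : ℕ)) (fun n : s => π n)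
    Subtype.val_injective (hπ.comp Subtype.val_injective)
  exact ⟨σ, fun n hn => hσ ⟨n, hn⟩⟩

lemma rename_congr_of_vars {K σ τ : Type*} [CommRing K] {f g : σ → τ} {p : MvPolynomial σ K}
    (h : ∀ i ∈ p.vars, f i = g i) : MvPolynomial.rename f p = MvPolynomial.rename g p := by
  refine MvPolynomial.hom_congr_vars (f₁ := (MvPolynomial.rename f : _ →ₐ[K] _).toRingHom)
    (f₂ := (MvPolynomial.rename g : _ →ₐ[K] _).toRingHom) ?_ (fun i hi _ => ?_) rfl
  · ext; simp
  · simp [h i hi]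

/-- Ascending chains of ideals of `K[x_{i,j}]` that are stable under permutations of the columns
stabilise (Cohen's theorem). -/
theorem symStable_ideal_chain_stabilizes {K : Type*} [CommRing K] [IsNoetherianRing K] {ι : Type*}
    [Finite ι] (J : ℕ →o Ideal (MvPolynomial (ι × ℕ) K))
    (hJ : ∀ n (σ : Equiv.Perm ℕ), ∀ f ∈ J n, MvPolynomial.rename (Prod.map id σ) f ∈ J n) :
    ∃ N, ∀ n, N ≤ n → J n = J N := by
  cases nonempty_fintype ι
  let _ : LinearOrder ι := LinearOrder.lift' (Fintype.equivFin ι) (Fintype.equivFin ι).injective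
  -- Variables are compared by column first, so that increasing column maps preserve their order.
  let e : ι × ℕ ≃ ℕ ×ₗ ι := (Equiv.prodComm ι ℕ).trans toLex
  let E := MvPolynomial.renameEquiv K e
  let lift (π : ℕ ↪o ℕ) : (ℕ ×ₗ ι) ↪o (ℕ ×ₗ ι) := OrderEmbedding.ofStrictMono
    (fun p => toLex (π (ofLex p).1, (ofLex p).2)) (fun p q h => by
      rcases (Prod.Lex.lt_iff.1 h) with h | ⟨h, h'⟩
      · exact Prod.Lex.lt_iff.2 (Or.inl (π.lt_iff_lt.2 h))
      · exact Prod.Lex.lt_iff.2 (Or.inr ⟨congrArg π h, h'⟩))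
  let I : ℕ → Ideal (MvPolynomial (ℕ ×ₗ ι) K) := fun n => (J n).comap E.symm
  have hImono : Monotone I := fun a b hab => Ideal.comap_mono (J.monotone hab)
  have hIstable : ∀ n (π : ℕ ↪o ℕ), ∀ f ∈ I n, MvPolynomial.rename (lift π) f ∈ I n := by
    intro n π f hf
    -- Only finitely many columns occur in `f`, and on these `π` agrees with a permutation.
    obtain ⟨σ, hσ⟩ := exists_perm_extending π.injective (f.vars.image fun p => (ofLex p).1)
    have h1 := hJ n σ _ hf
    change E.symm _ ∈ J n
    convert h1 using 1
    rw [AlgEquiv.symm_apply_eq]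
    change _ = MvPolynomial.rename e (MvPolynomial.rename _ (MvPolynomial.rename e.symm f))
    rw [MvPolynomial.rename_rename, MvPolynomial.rename_rename]
    refine rename_congr_of_vars fun p hp => ?_
    have := hσ _ (Finset.mem_image_of_mem _ hp)
    exact congrArg (fun x => toLex (x, (ofLex p).2)) this.symm
  by_contra! hcon
  have hstep : ∀ N, ∃ n m, N ≤ n ∧ ∃ n', n < n' ∧
      leadingCoeffIdeal (I n) m < leadingCoeffIdeal (I n') m := by
    intro N
    obtain ⟨n', hn', hne⟩ := hcon N
    by_contra! hall
    refine hne (Ideal.comap_injective_of_surjective E.symm E.symm.surjective ?_)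
    refine (eq_of_leadingCoeffIdeal_eq (hImono hn') fun m => ?_).symm
    refine (leadingCoeffIdeal_mono (hImono hn') m).eq_of_not_lt fun hlt => ?_
    rcases hn'.eq_or_lt with rfl | h
    · exact hne rfl
    · exact hall N m le_rfl n' h hlt
  choose a m ha b hab hlt using hstep
  -- Successive disjoint intervals from `a (s t)` to `b (s t)`, over each of which the coefficient
  -- ideal at `m (s t)` grows strictly. Along a subsequence where these exponents embed in one
  -- another, this gives a strictly increasing chain of ideals of `K`.
  let s : ℕ → ℕ := fun t => Nat.rec 0 (fun _ N => b N) t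
  have hs : StrictMono s := strictMono_nat_of_lt_succ fun t => (ha (s t)).trans_lt (hab (s t))
  obtain ⟨g, hg⟩ := exists_monotone_subseq_columnEmbeds
    (fun t n i => m (s t) (toLex (n, i))) (fun t => by
      refine ⟨((m (s t)).support.image fun p => (ofLex p).1).sup id + 1, fun n hn => ?_⟩
      funext i
      by_contra hne
      have : n ∈ (m (s t)).support.image fun p => (ofLex p).1 :=
        Finset.mem_image.2 ⟨toLex (n, i), Finsupp.mem_support_iff.2 hne, rfl⟩
      have := Finset.le_sup (f := id) this
      simp only [id] at this
      omega)
  have hchain : StrictMono fun t => leadingCoeffIdeal (I (a (s (g t)))) (m (s (g t))) := by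
    refine strictMono_nat_of_lt_succ fun t => (hlt (s (g t))).trans_le ?_
    have hlt' : g t + 1 ≤ g (t + 1) := g.lt_iff_lt.2 (Nat.lt_succ_self t)
    have h1 : b (s (g t)) ≤ a (s (g (t + 1))) := (hs.monotone hlt').trans (ha _)
    refine (leadingCoeffIdeal_mono (hImono h1) _).trans ?_
    obtain ⟨π, hπ⟩ := hg t (t + 1) (Nat.le_succ t)
    have hle : (m (s (g t))).mapDomain (lift π) ≤ m (s (g (t + 1))) := by
      intro p
      by_cases hr : p ∈ Set.range (lift π)
      · obtain ⟨p, rfl⟩ := hr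
        rw [Finsupp.mapDomain_apply (lift π).injective]
        exact hπ (ofLex p).1 (ofLex p).2
      · rw [Finsupp.mapDomain_of_notMem_range _ _ hr]
        exact zero_le
    have := leadingCoeffIdeal_le_of_rename (lift π) (hIstable (a (s (g (t + 1)))) π) (m (s (g t)))
      (m (s (g (t + 1))) - (m (s (g t))).mapDomain (lift π))
    rwa [tsub_add_cancel_of_le hle] at this
  obtain ⟨t, ht⟩ := monotone_stabilizes_iff_noetherian.2 ‹IsNoetherianRing K› ⟨_, hchain.monotone⟩
  exact (hchain (Nat.lt_succ_self t)).ne (ht (t + 1) (Nat.le_succ t))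

/-! ### Elements lying in a subalgebra up to an ideal and powers of `h`. -/

section Saturation

variable {K B : Type*} [CommRing K] [CommRing B] [Algebra K B]

/-- The elements that agree, modulo the ideal `V` and up to powers of `h`, with an element of the
subalgebra `P`. -/
def saturatedSubalgebra (V : Ideal B) (P : Subalgebra K B) (h : B) (hP : h ∈ P) :
    Subalgebra K B where
  carrier := {f | ∃ e : ℕ, ∃ g ∈ P, h ^ e * f - g ∈ V}
  mul_mem' := by
    rintro f₁ f₂ ⟨e₁, g₁, hg₁, h₁⟩ ⟨e₂, g₂, hg₂, h₂⟩
    refine ⟨e₁ + e₂, g₁ * g₂, P.mul_mem hg₁ hg₂, ?_⟩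
    have : h ^ (e₁ + e₂) * (f₁ * f₂) - g₁ * g₂ =
        (h ^ e₂ * f₂) * (h ^ e₁ * f₁ - g₁) + g₁ * (h ^ e₂ * f₂ - g₂) := by ring
    rw [this]
    exact V.add_mem (V.mul_mem_left _ h₁) (V.mul_mem_left _ h₂)
  add_mem' := by
    rintro f₁ f₂ ⟨e₁, g₁, hg₁, h₁⟩ ⟨e₂, g₂, hg₂, h₂⟩
    refine ⟨e₁ + e₂, h ^ e₂ * g₁ + h ^ e₁ * g₂,
      P.add_mem (P.mul_mem (P.pow_mem hP _) hg₁) (P.mul_mem (P.pow_mem hP _) hg₂), ?_⟩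
    have : h ^ (e₁ + e₂) * (f₁ + f₂) - (h ^ e₂ * g₁ + h ^ e₁ * g₂) =
        h ^ e₂ * (h ^ e₁ * f₁ - g₁) + h ^ e₁ * (h ^ e₂ * f₂ - g₂) := by ring
    rw [this]
    exact V.add_mem (V.mul_mem_left _ h₁) (V.mul_mem_left _ h₂)
  algebraMap_mem' := fun a => ⟨0, algebraMap K B a, P.algebraMap_mem a, by simp⟩

variable {V : Ideal B} {P : Subalgebra K B} {h : B} {hP : h ∈ P}

lemma le_saturatedSubalgebra : P ≤ saturatedSubalgebra V P h hP :=
  fun g hg => ⟨0, g, hg, by simp⟩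

lemma mem_saturatedSubalgebra_of_mem_ideal {f : B} (hf : f ∈ V) :
    f ∈ saturatedSubalgebra V P h hP :=
  ⟨0, 0, P.zero_mem, by simpa using hf⟩

lemma mem_saturatedSubalgebra_of_mul {f : B} (hf : h * f ∈ saturatedSubalgebra V P h hP) :
    f ∈ saturatedSubalgebra V P h hP := by
  obtain ⟨e, g, hg, hV⟩ := hf
  exact ⟨e + 1, g, hg, by rwa [pow_succ, mul_assoc]⟩

end Saturation

/-! ### Rank loci of flattenings and elimination by bordered minors. -/

section Minors

variable {d : ℕ}

/-- The multi-index with entries `i` at the positions in `A` and entries of `w` elsewhere. -/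
def slot (A : Finset (Fin d)) (i : ℕ) (w : Fin d → ℕ) : Fin d → ℕ :=
  fun l => if l ∈ A then i else w l

/-- A square submatrix of the flattening of the generic tensor in which the row index is placed at
all positions in `A`. -/
noncomputable def flatMatrix (K : Type u) [CommRing K] (A : Finset (Fin d)) {r : ℕ} (I : Fin r → ℕ)
    (W : Fin r → Fin d → ℕ) : Matrix (Fin r) (Fin r) (MvPolynomial (Fin d → ℕ) K) :=
  Matrix.of fun a b => MvPolynomial.X (slot A (I a) (W b))

/-- The row indices are at least `n` and do not occur in the column indices. -/
def Admissible (n : ℕ) (A : Finset (Fin d)) {r : ℕ} (I : Fin r → ℕ) (W : Fin r → Fin d → ℕ) :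
    Prop :=
  (∀ a, n ≤ I a) ∧ ∀ a b, ∀ l ∉ A, W b l ≠ I a

variable {K : Type u} [CommRing K]

/-- All admissible minors of size `r` of the flattening along `A` vanish at `p`. -/
def MinorsVanish (p : PrimeSpectrum (MvPolynomial (Fin d → ℕ) K)) (n : ℕ) (A : Finset (Fin d))
    (r : ℕ) : Prop :=
  ∀ (I : Fin r → ℕ) (W : Fin r → Fin d → ℕ), Admissible n A I W →
    (flatMatrix K A I W).det ∈ p.asIdeal

/-- The locus where for each `A` the admissible minors of size `r A` vanish. -/
def rankLocus (K : Type u) [CommRing K] (n : ℕ) (r : Finset (Fin d) → ℕ) :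
    Set (PrimeSpectrum (MvPolynomial (Fin d → ℕ) K)) :=
  {p | ∀ A, MinorsVanish p n A (r A)}

lemma isClosed_rankLocus (n : ℕ) (r : Finset (Fin d) → ℕ) : IsClosed (rankLocus K n r) := by
  simp only [rankLocus, MinorsVanish, Set.ofPred_forall]
  refine isClosed_iInter fun A => isClosed_iInter fun I => isClosed_iInter fun W =>
    isClosed_iInter fun _ => ?_
  convert PrimeSpectrum.isClosed_zeroLocus {(flatMatrix K A I W).det} using 1
  ext p
  simp [PrimeSpectrum.mem_zeroLocus]

lemma map_det_flatMatrix (σ : Equiv.Perm ℕ) (A : Finset (Fin d)) {r : ℕ} (I : Fin r → ℕ)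
    (W : Fin r → Fin d → ℕ) :
    tensorRingAct K d σ (flatMatrix K A I W).det =
      (flatMatrix K A (fun a => σ (I a)) (fun b l => σ (W b l))).det := by
  rw [AlgHom.map_det]
  congr 1
  ext1 a b
  simp only [AlgHom.mapMatrix_apply, Matrix.map_apply, flatMatrix, Matrix.of_apply, tensorRingAct,
    MvPolynomial.rename_X]
  congr 1
  funext l
  simp only [slot]
  split_ifs <;> rfl

/-- The coordinates with at most one index outside `{0, …, m - 1}`. -/
noncomputable def wideParam (K : Type u) [CommRing K] (d m : ℕ) :
    MvPolynomial ((Finset (Fin d) × (Fin d → Fin m)) × ℕ) K →ₐ[K] MvPolynomial (Fin d → ℕ) K :=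
  MvPolynomial.aeval fun p => MvPolynomial.X (slot p.1.1 (m + p.2) fun l => p.1.2 l)

lemma X_mem_range_wideParam {m : ℕ} (hm : 0 < m) {v : Fin d → ℕ} {i : ℕ}
    (hv : ∀ l, v l < m ∨ v l = i) : MvPolynomial.X v ∈ (wideParam K d m).range := by
  rcases lt_or_ge i m with hi | hi
  · have hv' : ∀ l, v l < m := fun l => (hv l).elim id fun h => h ▸ hi
    refine ⟨MvPolynomial.X ((∅, fun l => ⟨v l, hv' l⟩), 0), ?_⟩
    change wideParam K d m _ = _
    rw [wideParam, MvPolynomial.aeval_X]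
    congr 1
  -- The default `0` sits only at positions that `slot` overwrites with `i`.
  · refine ⟨MvPolynomial.X ((Finset.univ.filter fun l => v l = i,
      fun l => if h : v l < m then ⟨v l, h⟩ else ⟨0, hm⟩), i - m), ?_⟩
    change wideParam K d m _ = _
    rw [wideParam, MvPolynomial.aeval_X]
    congr 1
    funext l
    simp only [slot, Finset.mem_filter, Finset.mem_univ, true_and]
    split_ifs with h1 h2
    · omega
    · rfl
    · exact absurd (hv l) (by tauto)

lemma det_mem_of_forall_mem {B : Type*} [CommRing B] [Algebra K B] (P : Subalgebra K B) {r : ℕ}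
    {M : Matrix (Fin r) (Fin r) B} (h : ∀ a b, M a b ∈ P) : M.det ∈ P := by
  rw [Matrix.det_apply']
  exact P.sum_mem fun σ _ => P.mul_mem (intCast_mem P _) (P.prod_mem fun i _ => h _ _)

/-- For each `A`, `d + 1` choices of rows and columns of square submatrices of size `q A`. -/
abbrev MinorFamily (d : ℕ) (q : Finset (Fin d) → ℕ) : Type :=
  ∀ A : Finset (Fin d), Fin (d + 1) → (Fin (q A) → ℕ) × (Fin (q A) → Fin d → ℕ)

/-- The minors of the family are admissible, involve only indices less than `m`, and for each `A`
use pairwise disjoint sets of rows. -/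
structure MinorFamily.Good {q : Finset (Fin d) → ℕ} (c : MinorFamily d q) (n m : ℕ) : Prop where
  admissible : ∀ A t, Admissible n A (c A t).1 (c A t).2
  row_lt : ∀ A t a, (c A t).1 a < m
  col_lt : ∀ A t b l, (c A t).2 b l < m
  disjoint : ∀ A t t', t ≠ t' → ∀ a a', (c A t).1 a ≠ (c A t').1 a'

/-- The product of all minors of the family. -/
noncomputable def MinorFamily.prod (K : Type u) [CommRing K] {q : Finset (Fin d) → ℕ}
    (c : MinorFamily d q) :
    MvPolynomial (Fin d → ℕ) K :=
  ∏ A, ∏ t, (flatMatrix K A (c A t).1 (c A t).2).det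

variable {q : Finset (Fin d) → ℕ} {c : MinorFamily d q} {n m : ℕ}

lemma MinorFamily.Good.det_mem_range (hc : c.Good n m) (hm : 0 < m) (A : Finset (Fin d))
    (t : Fin (d + 1)) : (flatMatrix K A (c A t).1 (c A t).2).det ∈ (wideParam K d m).range := by
  refine det_mem_of_forall_mem _ fun a b => X_mem_range_wideParam hm (i := 0) fun l => Or.inl ?_
  simp only [slot]
  split_ifs
  · exact hc.row_lt A t a
  · exact hc.col_lt A t b l

lemma MinorFamily.Good.prod_mem_range (hc : c.Good n m) (hm : 0 < m) :
    c.prod K ∈ (wideParam K d m).range :=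
  Subalgebra.prod_mem _ fun A _ => Subalgebra.prod_mem _ fun t _ => hc.det_mem_range hm A t

/-- Pigeonhole: the `d` entries of `v` cannot meet `d + 1` disjoint row sets. This makes the
bordered minor admissible. -/
lemma MinorFamily.Good.exists_row_notMem (hc : c.Good n m) (A : Finset (Fin d)) (v : Fin d → ℕ) :
    ∃ t, ∀ a l, v l ≠ (c A t).1 a := by
  by_contra! h
  choose a l hl using h
  obtain ⟨t, t', hne, heq⟩ := Fintype.exists_ne_map_eq_of_card_lt l (by simp)
  exact hc.disjoint A t t' hne (a t) (a t') (by rw [← hl, ← hl, heq])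

/-- Border a minor by the row `i` and the column `v`, where `i` is a large entry of `v`, and expand
along that column. The corner gives `X v` times a factor of `c.prod K`; the other entries have fewer
distinct large indices, and their cofactors involve no large index but `i`. -/
lemma MinorFamily.Good.X_mem_saturated (hc : c.Good n m) (hm : 0 < m) (hn : n ≤ m)
    (v : Fin d → ℕ) :
    MvPolynomial.X v ∈ saturatedSubalgebra
      (PrimeSpectrum.vanishingIdeal (rankLocus K n fun A => q A + 1)) (wideParam K d m).range
      (c.prod K) (hc.prod_mem_range hm) := by
  induction hk : ((Finset.univ.image v).filter (m ≤ ·)).card using Nat.strong_induction_on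
    generalizing v with
  | _ k ih =>
    by_cases hv : ∃ i, ∀ l, v l < m ∨ v l = i
    · obtain ⟨i, hi⟩ := hv
      exact le_saturatedSubalgebra (X_mem_range_wideParam hm hi)
    push Not at hv
    obtain ⟨l₀, hl₀, -⟩ := hv 0
    set i := v l₀ with hi
    set A : Finset (Fin d) := Finset.univ.filter fun l => v l = i with hA
    have hmemA : ∀ l, l ∈ A ↔ v l = i := by simp [hA]
    obtain ⟨t, ht⟩ := hc.exists_row_notMem A v
    set S := saturatedSubalgebra
      (PrimeSpectrum.vanishingIdeal (rankLocus K n fun A => q A + 1)) (wideParam K d m).range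
      (c.prod K) (hc.prod_mem_range hm) with hS
    have hslot : slot A i v = v := by
      funext l
      simp only [slot]
      split_ifs with h
      · exact ((hmemA l).1 h).symm
      · rfl
    let I : Fin (q A + 1) → ℕ := Fin.cons i (c A t).1
    let W : Fin (q A + 1) → Fin d → ℕ := Fin.cons v (c A t).2
    have hadm : Admissible n A I W := by
      constructor
      · intro a
        refine Fin.cases ?_ (fun a => ?_) a
        · exact hn.trans hl₀
        · exact (hc.admissible A t).1 a
      · intro a b l hl
        refine Fin.cases ?_ (fun a => ?_) a <;> refine Fin.cases ?_ (fun b => ?_) b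
        · exact fun h => hl ((hmemA l).2 h)
        · exact ((hc.col_lt A t b l).trans_le hl₀).ne
        · exact ht a l
        · exact (hc.admissible A t).2 a b l hl
    have hdet : (flatMatrix K A I W).det ∈ S := by
      refine mem_saturatedSubalgebra_of_mem_ideal ?_
      rw [PrimeSpectrum.mem_vanishingIdeal]
      exact fun p hp => hp A I W hadm
    rw [Matrix.det_succ_column_zero, Fin.sum_univ_succ] at hdet
    have hrest : ∑ a : Fin (q A), (-1 : MvPolynomial (Fin d → ℕ) K) ^ (a.succ : ℕ) *
        flatMatrix K A I W a.succ 0 *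
          ((flatMatrix K A I W).submatrix a.succ.succAbove Fin.succ).det ∈ S := by
      refine S.sum_mem fun a _ => S.mul_mem (S.mul_mem (S.pow_mem (S.neg_mem S.one_mem) _) ?_) ?_
      · refine ih _ ?_ (slot A ((c A t).1 a) v) rfl
        rw [← hk]
        refine Finset.card_lt_card ⟨fun j hj => ?_, fun hsub => ?_⟩
        · simp only [Finset.mem_filter, Finset.mem_image, Finset.mem_univ, true_and, slot] at hj ⊢
          obtain ⟨⟨l, hl⟩, hj⟩ := hj
          split_ifs at hl
          · have := hc.row_lt A t a
            omega
          · exact ⟨⟨l, hl⟩, hj⟩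
        · have := @hsub i (by simpa [hi] using hl₀)
          simp only [Finset.mem_filter, Finset.mem_image, Finset.mem_univ, true_and, slot] at this
          obtain ⟨⟨l, hl⟩, -⟩ := this
          split_ifs at hl with h
          · have := hc.row_lt A t a
            omega
          · exact h ((hmemA l).2 hl)
      · refine le_saturatedSubalgebra (det_mem_of_forall_mem _ fun a' b =>
          X_mem_range_wideParam hm (i := i) fun l => ?_)
        simp only [slot]
        split_ifs
        · generalize Fin.succAbove _ a' = x
          refine Fin.cases ?_ (fun x => ?_) x
          · exact Or.inr rfl
          · exact Or.inl (hc.row_lt A t x)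
        · exact Or.inl (hc.col_lt A t b l)
    have hmain := S.sub_mem hdet hrest
    rw [add_sub_cancel_right] at hmain
    have hX : flatMatrix K A I W 0 0 = MvPolynomial.X v := congrArg MvPolynomial.X hslot
    have hsubm : (flatMatrix K A I W).submatrix (Fin.succAbove 0) Fin.succ =
      flatMatrix K A (c A t).1 (c A t).2 := rfl
    rw [hX, hsubm] at hmain
    simp only [Fin.val_zero, pow_zero, one_mul] at hmain
    refine mem_saturatedSubalgebra_of_mul ?_
    have hfac : c.prod K =
        (∏ A' ∈ Finset.univ.erase A, ∏ t, (flatMatrix K A' (c A' t).1 (c A' t).2).det) *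
        (∏ t' ∈ Finset.univ.erase t, (flatMatrix K A (c A t').1 (c A t').2).det) *
          (flatMatrix K A (c A t).1 (c A t).2).det := by
      rw [mul_assoc, Finset.prod_erase_mul _ _ (Finset.mem_univ t),
        Finset.prod_erase_mul _ _ (Finset.mem_univ A)]
      rfl
    suffices c.prod K * MvPolynomial.X v ∈ S from this
    rw [hfac, mul_assoc, mul_comm (Matrix.det _)]
    refine S.mul_mem (le_saturatedSubalgebra (Subalgebra.mul_mem _ ?_ ?_)) hmain
    · exact Subalgebra.prod_mem _ fun A _ => Subalgebra.prod_mem _ fun t _ =>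
        hc.det_mem_range hm A t
    · exact Subalgebra.prod_mem _ fun t _ => hc.det_mem_range hm A t

lemma MinorFamily.Good.exists_pow_mul_sub_mem (hc : c.Good n m) (hm : 0 < m) (hn : n ≤ m)
    (f : MvPolynomial (Fin d → ℕ) K) :
    ∃ e : ℕ, ∃ g, c.prod K ^ e * f - wideParam K d m g ∈
      PrimeSpectrum.vanishingIdeal (rankLocus K n fun A => q A + 1) := by
  have htop : (⊤ : Subalgebra K (MvPolynomial (Fin d → ℕ) K)) ≤ saturatedSubalgebra
      (PrimeSpectrum.vanishingIdeal (rankLocus K n fun A => q A + 1)) (wideParam K d m).range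
      (c.prod K) (hc.prod_mem_range hm) := by
    rw [← MvPolynomial.adjoin_range_X, Algebra.adjoin_le_iff]
    rintro _ ⟨v, rfl⟩
    exact hc.X_mem_saturated hm hn v
  obtain ⟨e, _, ⟨g, rfl⟩, h⟩ := htop (Algebra.mem_top (x := f))
  exact ⟨e, g, h⟩

end Minors

/-! ### Stabilisation of chains on pieces of a rank locus. -/

section Stabilization

variable {K : Type u} [CommRing K] {d : ℕ}

/-- The map on points of the tensor space induced by `σ` acting on coordinates. -/
noncomputable abbrev tensorComap (K : Type u) [CommRing K] (d : ℕ) (σ : Equiv.Perm ℕ)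
    (p : PrimeSpectrum (MvPolynomial (Fin d → ℕ) K)) : PrimeSpectrum (MvPolynomial (Fin d → ℕ) K) :=
  PrimeSpectrum.comap (tensorRingAct K d σ).toRingHom p

lemma mem_tensorComap {σ : Equiv.Perm ℕ} {p : PrimeSpectrum (MvPolynomial (Fin d → ℕ) K)}
    {f : MvPolynomial (Fin d → ℕ) K} :
    f ∈ (tensorComap K d σ p).asIdeal ↔ tensorRingAct K d σ f ∈ p.asIdeal := Iff.rfl

lemma tensorRingAct_mul (σ τ : Equiv.Perm ℕ) (f : MvPolynomial (Fin d → ℕ) K) :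
    tensorRingAct K d (σ * τ) f = tensorRingAct K d σ (tensorRingAct K d τ f) := by
  rw [tensorRingAct, tensorRingAct, tensorRingAct, MvPolynomial.rename_rename]
  rfl

lemma tensorRingAct_one (f : MvPolynomial (Fin d → ℕ) K) : tensorRingAct K d 1 f = f :=
  MvPolynomial.rename_id_apply f

lemma tensorComap_inv_tensorComap (σ : Equiv.Perm ℕ)
    (p : PrimeSpectrum (MvPolynomial (Fin d → ℕ) K)) :
    tensorComap K d σ⁻¹ (tensorComap K d σ p) = p := by
  ext f
  rw [mem_tensorComap, mem_tensorComap, ← tensorRingAct_mul, mul_inv_cancel, tensorRingAct_one]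

/-- The permutation fixes all indices less than `n`. -/
def FixesBelow (n : ℕ) (σ : Equiv.Perm ℕ) : Prop := ∀ j < n, σ j = j

lemma FixesBelow.inv {n : ℕ} {σ : Equiv.Perm ℕ} (h : FixesBelow n σ) : FixesBelow n σ⁻¹ :=
  fun j hj => Equiv.Perm.inv_eq_iff_eq.2 (h j hj).symm

lemma FixesBelow.le_apply {n : ℕ} {σ : Equiv.Perm ℕ} (h : FixesBelow n σ) {j : ℕ} (hj : n ≤ j) :
    n ≤ σ j := by
  by_contra! hlt
  have := σ.injective (h _ hlt)
  omega

/-- Stability under the permutations that fix all indices less than `n`. -/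
def StableAbove (n : ℕ) (Z : Set (PrimeSpectrum (MvPolynomial (Fin d → ℕ) K))) : Prop :=
  ∀ σ, FixesBelow n σ → ∀ p ∈ Z, tensorComap K d σ p ∈ Z

/-- Descending chains of closed sets stable under the permutations fixing all indices less than `n`
stabilise on `Z`. -/
def StabilizesOn (n : ℕ) (Z : Set (PrimeSpectrum (MvPolynomial (Fin d → ℕ) K))) : Prop :=
  ∀ X : ℕ → Set (PrimeSpectrum (MvPolynomial (Fin d → ℕ) K)), (∀ i, IsClosed (X i)) →
    (∀ i, StableAbove n (X i)) → Antitone X → ∃ N, ∀ i, N ≤ i → X N ∩ Z ⊆ X i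

lemma StabilizesOn.of_le {n n' : ℕ} {Z : Set (PrimeSpectrum (MvPolynomial (Fin d → ℕ) K))}
    (h : StabilizesOn n' Z) (hn : n ≤ n') : StabilizesOn n Z :=
  fun X hc hs ha => h X hc (fun i σ hσ => hs i σ fun j hj => hσ j (hj.trans_le hn)) ha

/-- A point is moved into a piece, compared there, and moved back; the members of the chain are
stable under both moves. -/
lemma StabilizesOn.of_cover {ι : Type*} [Finite ι] {n : ℕ}
    {Z : Set (PrimeSpectrum (MvPolynomial (Fin d → ℕ) K))}
    {U : ι → Set (PrimeSpectrum (MvPolynomial (Fin d → ℕ) K))} (hU : ∀ i, StabilizesOn n (U i))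
    (hcov : ∀ p ∈ Z, ∃ i σ, FixesBelow n σ ∧ tensorComap K d σ p ∈ U i) : StabilizesOn n Z := by
  intro X hc hs ha
  choose N hN using fun i => hU i X hc hs ha
  cases nonempty_fintype ι
  refine ⟨Finset.univ.sup N, fun j hj p hp => ?_⟩
  obtain ⟨i, σ, hσ, hi⟩ := hcov p hp.2
  have hle : N i ≤ Finset.univ.sup N := Finset.le_sup (Finset.mem_univ i)
  have := hN i j (hle.trans hj) ⟨ha hle (hs _ σ hσ p hp.1), hi⟩
  simpa only [tensorComap_inv_tensorComap] using hs j σ⁻¹ hσ.inv _ this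

lemma stableAbove_rankLocus (n : ℕ) (r : Finset (Fin d) → ℕ) :
    StableAbove n (rankLocus K n r) := by
  intro σ hσ p hp A I W h
  rw [mem_tensorComap, map_det_flatMatrix]
  exact hp A _ _ ⟨fun a => hσ.le_apply (h.1 a), fun a b l hl => σ.injective.ne (h.2 a b l hl)⟩

lemma exists_fixesBelow_map_lt (n : ℕ) (s : Finset ℕ) :
    ∃ σ, FixesBelow n σ ∧ ∀ i ∈ s, σ i < n + s.card := by
  -- Indices outside `s` go beyond `n + s.card` only to keep `π` injective.
  let π : ℕ → ℕ := fun i => if i < n then i else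
    if h : i ∈ s then n + s.equivFin ⟨i, h⟩ else i + n + s.card
  have hlt : ∀ i (h : i ∈ s), (s.equivFin ⟨i, h⟩ : ℕ) < s.card := fun i h => Fin.is_lt _
  have hπ : Function.Injective π := by
    intro i j hij
    simp only [π] at hij
    split_ifs at hij with h1 h2 h3 h4 h5 h6 h7 h8
    · exact hij
    · omega
    · omega
    · omega
    · have := s.equivFin.injective (Fin.ext (Nat.add_left_cancel hij))
      simpa using this
    · have := hlt i ‹_›
      omega
    · omega
    · have := hlt j ‹_›
      omega
    · omega
  obtain ⟨σ, hσ⟩ := exists_perm_extending hπ (s ∪ Finset.range n)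
  refine ⟨σ, fun j hj => ?_, fun i hi => ?_⟩
  · rw [hσ j (by simp [hj])]
    simp [π, hj]
  · rw [hσ i (by simp [hi])]
    simp only [π, hi, dif_pos]
    have := hlt i hi
    split_ifs <;> omega

/-- The permutation that acts as `σ` on the indices at least `m`. -/
noncomputable def shiftPerm (m : ℕ) (σ : Equiv.Perm ℕ) : Equiv.Perm ℕ where
  toFun j := if j < m then j else m + σ (j - m)
  invFun j := if j < m then j else m + σ.symm (j - m)
  left_inv j := by
    by_cases h : j < m
    · simp [h]
    · simp [h]; omega
  right_inv j := by
    by_cases h : j < m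
    · simp [h]
    · simp [h]; omega

lemma fixesBelow_shiftPerm (m : ℕ) (σ : Equiv.Perm ℕ) : FixesBelow m (shiftPerm m σ) :=
  fun j hj => by simp [shiftPerm, hj]

lemma wideParam_rename (m : ℕ) (σ : Equiv.Perm ℕ)
    (f : MvPolynomial ((Finset (Fin d) × (Fin d → Fin m)) × ℕ) K) :
    wideParam K d m (MvPolynomial.rename (Prod.map id σ) f) =
      tensorRingAct K d (shiftPerm m σ) (wideParam K d m f) := by
  suffices (wideParam K d m).comp (MvPolynomial.rename (Prod.map id σ)) =
      (tensorRingAct K d (shiftPerm m σ)).comp (wideParam K d m) from DFunLike.congr_fun this f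
  refine MvPolynomial.algHom_ext fun p => ?_
  simp only [AlgHom.comp_apply, MvPolynomial.rename_X, wideParam, MvPolynomial.aeval_X,
    tensorRingAct]
  congr 1
  funext l
  simp only [slot, Prod.map, id]
  split_ifs
  · simp [shiftPerm]
  · simp [shiftPerm]

/-- Cohen's theorem stabilises the pullbacks of the vanishing ideals along `wideParam`. These
determine the closed sets where `c.prod K` is invertible, since there every `f` is, modulo the locus
and a power of that product, in the image of `wideParam`. -/
lemma MinorFamily.Good.stabilizesOn [IsNoetherianRing K] {q : Finset (Fin d) → ℕ}
    {c : MinorFamily d q} {n m : ℕ} (hc : c.Good n m) (hm : 0 < m) (hn : n ≤ m) :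
    StabilizesOn m (rankLocus K n (fun A => q A + 1) ∩ {p | c.prod K ∉ p.asIdeal}) := by
  intro X hcl hst hanti
  set Y := rankLocus K n (fun A => q A + 1) with hY
  have hCcl : ∀ i, IsClosed (X i ∩ Y) := fun i => (hcl i).inter (isClosed_rankLocus _ _)
  let J : ℕ →o Ideal (MvPolynomial ((Finset (Fin d) × (Fin d → Fin m)) × ℕ) K) :=
    ⟨fun i => (PrimeSpectrum.vanishingIdeal (X i ∩ Y)).comap (wideParam K d m), fun i j hij =>
      Ideal.comap_mono (PrimeSpectrum.vanishingIdeal_anti_mono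
        (Set.inter_subset_inter_left _ (hanti hij)))⟩
  obtain ⟨N, hN⟩ := symStable_ideal_chain_stabilizes J (by
    intro i σ f hf
    change wideParam K d m _ ∈ PrimeSpectrum.vanishingIdeal _
    rw [wideParam_rename, PrimeSpectrum.mem_vanishingIdeal]
    intro p hp
    have hf' : wideParam K d m f ∈ PrimeSpectrum.vanishingIdeal (X i ∩ Y) := hf
    have hfix := fixesBelow_shiftPerm m σ
    exact (PrimeSpectrum.mem_vanishingIdeal _ _).1 hf' _ ⟨hst i _ hfix p hp.1,
      stableAbove_rankLocus n _ _ (fun j hj => hfix j (hj.trans_le hn)) p hp.2⟩)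
  refine ⟨N, fun i hi p hp => ?_⟩
  suffices p ∈ X i ∩ Y from this.1
  rw [← (hCcl i).closure_eq, ← PrimeSpectrum.zeroLocus_vanishingIdeal_eq_closure,
    PrimeSpectrum.mem_zeroLocus]
  intro f hf
  obtain ⟨e, g, hg⟩ := hc.exists_pow_mul_sub_mem (K := K) hm hn f
  have h1 : g ∈ J i := by
    change wideParam K d m g ∈ PrimeSpectrum.vanishingIdeal (X i ∩ Y)
    have h2 := PrimeSpectrum.vanishingIdeal_anti_mono Set.inter_subset_right hg
      (s := X i ∩ Y)
    have h3 := Ideal.sub_mem _ (Ideal.mul_mem_left _ (c.prod K ^ e) hf) h2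
    simpa using h3
  rw [hN i hi] at h1
  have h4 : wideParam K d m g ∈ p.asIdeal :=
    (PrimeSpectrum.mem_vanishingIdeal _ _).1 h1 p ⟨hp.1, hp.2.1⟩
  have h5 := Ideal.add_mem _ ((PrimeSpectrum.mem_vanishingIdeal _ _).1 hg p hp.2.1) h4
  rw [sub_add_cancel] at h5
  rcases p.isPrime.mem_or_mem h5 with h | h
  · exact absurd (p.isPrime.mem_of_pow_mem _ h) hp.2.2
  · exact h

end Stabilization

/-! ### Induction on the ranks. -/

section RankInduction

variable {K : Type u} [CommRing K] {d : ℕ}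

/-- Choose row-disjoint nonvanishing minors greedily: if this stops after at most `d` of them, their
rows form the hitting set. -/
lemma exists_hitting_set_or_disjoint_minors (p : PrimeSpectrum (MvPolynomial (Fin d → ℕ) K))
    (n : ℕ) (A : Finset (Fin d)) (r : ℕ) :
    (∃ S : Finset ℕ, S.card ≤ d * r ∧ ∀ (I : Fin r → ℕ) (W : Fin r → Fin d → ℕ),
      Admissible n A I W → (∀ a, I a ∉ S) → (flatMatrix K A I W).det ∈ p.asIdeal) ∨
    ∃ c : Fin (d + 1) → (Fin r → ℕ) × (Fin r → Fin d → ℕ),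
      (∀ t, Admissible n A (c t).1 (c t).2 ∧ (flatMatrix K A (c t).1 (c t).2).det ∉ p.asIdeal) ∧
      ∀ t t', t ≠ t' → ∀ a a', (c t).1 a ≠ (c t').1 a' := by
  rw [or_iff_not_imp_left]
  intro hS
  push Not at hS
  have key : ∀ t ≤ d + 1, ∃ c : ℕ → (Fin r → ℕ) × (Fin r → Fin d → ℕ), ∀ s < t,
      (Admissible n A (c s).1 (c s).2 ∧ (flatMatrix K A (c s).1 (c s).2).det ∉ p.asIdeal) ∧
      ∀ s' < s, ∀ a a', (c s).1 a ≠ (c s').1 a' := by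
    intro t
    induction t with
    | zero => exact fun _ => ⟨fun _ => (0, 0), by simp⟩
    | succ t ih =>
      intro ht
      obtain ⟨c, hc⟩ := ih (by omega)
      obtain ⟨I, W, hadm, hI, hdet⟩ := hS
        ((Finset.range t).biUnion fun s => Finset.univ.image (c s).1) (by
          refine Finset.card_biUnion_le.trans ((Finset.sum_le_card_nsmul _ _ r fun s _ =>
            Finset.card_image_le.trans (by simp)).trans ?_)
          rw [Finset.card_range, smul_eq_mul]
          exact Nat.mul_le_mul_right r (by omega))
      refine ⟨Function.update c t (I, W), fun s hs => ?_⟩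
      rcases Nat.lt_succ_iff_lt_or_eq.1 hs with hs | rfl
      · rw [Function.update_of_ne hs.ne]
        refine ⟨(hc s hs).1, fun s' hs' => ?_⟩
        rw [Function.update_of_ne (hs'.trans hs).ne]
        exact (hc s hs).2 s' hs'
      · rw [Function.update_self]
        refine ⟨⟨hadm, hdet⟩, fun s' hs' a a' heq => hI a ?_⟩
        rw [Function.update_of_ne hs'.ne] at heq
        simp only [Finset.mem_biUnion, Finset.mem_range, Finset.mem_image, Finset.mem_univ, true_and]
        exact ⟨s', hs', a', heq.symm⟩
  obtain ⟨c, hc⟩ := key (d + 1) le_rfl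
  refine ⟨fun t => c t, fun t => (hc t t.2).1, fun t t' hne a a' => ?_⟩
  rcases lt_or_gt_of_ne (Fin.val_ne_of_ne hne) with h | h
  · exact ((hc t' t'.2).2 t h a' a).symm
  · exact (hc t t.2).2 t' h a a'

/-- Once `S` has been moved below the new threshold, no admissible row can meet it, so the size for
`A` drops by one. -/
lemma exists_fixesBelow_mem_rankLocus_update {q : Finset (Fin d) → ℕ} {n : ℕ}
    {p : PrimeSpectrum (MvPolynomial (Fin d → ℕ) K)} (hp : p ∈ rankLocus K n fun A => q A + 1)
    {A : Finset (Fin d)} {S : Finset ℕ} (hS : S.card ≤ d * q A)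
    (h : ∀ (I : Fin (q A) → ℕ) (W : Fin (q A) → Fin d → ℕ),
      Admissible n A I W → (∀ a, I a ∉ S) → (flatMatrix K A I W).det ∈ p.asIdeal) :
    ∃ σ, FixesBelow n σ ∧ tensorComap K d σ p ∈
      rankLocus K (n + d * q A) (Function.update (fun A => q A + 1) A (q A)) := by
  obtain ⟨σ, hσ, hlt⟩ := exists_fixesBelow_map_lt n S
  have hadm : ∀ {A' : Finset (Fin d)} {r : ℕ} {I : Fin r → ℕ} {W : Fin r → Fin d → ℕ},
      Admissible (n + d * q A) A' I W →
        Admissible n A' (fun a => σ⁻¹ (I a)) (fun b l => σ⁻¹ (W b l)) := fun h =>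
    ⟨fun a => hσ.inv.le_apply ((Nat.le_add_right _ _).trans (h.1 a)),
      fun a b l hl => σ⁻¹.injective.ne (h.2 a b l hl)⟩
  refine ⟨σ⁻¹, hσ.inv, fun A' => ?_⟩
  by_cases hA : A' = A
  · subst hA
    rw [Function.update_self]
    intro I W hIW
    rw [mem_tensorComap, map_det_flatMatrix]
    refine h _ _ (hadm hIW) fun a ha => ?_
    have h1 := hlt _ ha
    have h2 := hIW.1 a
    have h3 : σ (σ⁻¹ (I a)) = I a := σ.apply_symm_apply _
    omega
  · rw [Function.update_of_ne hA]
    intro I W hIW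
    rw [mem_tensorComap, map_det_flatMatrix]
    exact hp A' _ _ (hadm hIW)

/-- The positions of the indices occurring in a family of minors. -/
abbrev MinorFamily.Position (d : ℕ) (q : Finset (Fin d) → ℕ) : Type :=
  Σ A : Finset (Fin d), Fin (d + 1) × (Fin (q A) ⊕ Fin (q A) × Fin d)

lemma exists_fixesBelow_good {q : Finset (Fin d) → ℕ} {n m : ℕ}
    (hm : n + Fintype.card (MinorFamily.Position d q) ≤ m)
    {p : PrimeSpectrum (MvPolynomial (Fin d → ℕ) K)} {c : MinorFamily d q}
    (hc : ∀ A t, Admissible n A (c A t).1 (c A t).2 ∧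
      (flatMatrix K A (c A t).1 (c A t).2).det ∉ p.asIdeal)
    (hdisj : ∀ A t t', t ≠ t' → ∀ a a', (c A t).1 a ≠ (c A t').1 a') :
    ∃ σ, FixesBelow n σ ∧ ∃ c' : MinorFamily d q, c'.Good n m ∧
      c'.prod K ∉ (tensorComap K d σ p).asIdeal := by
  let F : MinorFamily.Position d q → ℕ := fun x =>
    Sum.elim (fun a => (c x.1 x.2.1).1 a) (fun y => (c x.1 x.2.1).2 y.1 y.2) x.2.2
  obtain ⟨σ, hσ, hlt⟩ := exists_fixesBelow_map_lt n (Finset.univ.image F)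
  have hF : ∀ x, σ (F x) < m := fun x =>
    (hlt _ (Finset.mem_image_of_mem F (Finset.mem_univ x))).trans_le
      ((Nat.add_le_add_left Finset.card_image_le n).trans hm)
  refine ⟨σ⁻¹, hσ.inv, fun A t => (fun a => σ ((c A t).1 a), fun b l => σ ((c A t).2 b l)),
    ⟨fun A t => ⟨fun a => hσ.le_apply ((hc A t).1.1 a), fun a b l hl =>
      σ.injective.ne ((hc A t).1.2 a b l hl)⟩, fun A t a => hF ⟨A, t, Sum.inl a⟩,
      fun A t b l => hF ⟨A, t, Sum.inr (b, l)⟩,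
      fun A t t' h a a' => σ.injective.ne (hdisj A t t' h a a')⟩, fun hmem => ?_⟩
  obtain ⟨A, -, hmem⟩ := (tensorComap K d σ⁻¹ p).isPrime.prod_mem_iff.1 hmem
  obtain ⟨t, -, hmem⟩ := (tensorComap K d σ⁻¹ p).isPrime.prod_mem_iff.1 hmem
  rw [mem_tensorComap, map_det_flatMatrix] at hmem
  have hinv : ∀ x, σ⁻¹ (σ x) = x := σ.symm_apply_apply
  simp only [hinv] at hmem
  exact (hc A t).2 hmem

theorem stabilizesOn_rankLocus [IsNoetherianRing K] (n : ℕ) (r : Finset (Fin d) → ℕ) :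
    StabilizesOn n (rankLocus K n r) := by
  induction hk : ∑ A, r A using Nat.strong_induction_on generalizing n r with
  | _ k ih =>
    by_cases h0 : ∃ A, r A = 0
    · obtain ⟨A, hA⟩ := h0
      -- The empty minor is `1`, so the locus is empty.
      refine fun X _ _ _ => ⟨0, fun i _ p hp => absurd (hp.2 A) ?_⟩
      rw [hA]
      intro h
      have := h Fin.elim0 Fin.elim0 ⟨fun a => a.elim0, fun a => a.elim0⟩
      rw [Matrix.det_fin_zero] at this
      exact p.isPrime.ne_top ((Ideal.eq_top_iff_one _).2 this)
    push Not at h0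
    obtain ⟨q, rfl⟩ : ∃ q : Finset (Fin d) → ℕ, r = fun A => q A + 1 :=
      ⟨fun A => r A - 1, funext fun A => (Nat.succ_pred_eq_of_ne_zero (h0 A)).symm⟩
    -- All indices of a family fit below `m`, which does not depend on the point, so there are
    -- finitely many pieces; the final `1` makes `m` positive.
    set m := n + Fintype.card (MinorFamily.Position d q) + 1 with hm
    let C := {c : ∀ A : Finset (Fin d), Fin (d + 1) →
      (Fin (q A) → Fin m) × (Fin (q A) → Fin d → Fin m) //
        MinorFamily.Good (fun A t => (fun a => (c A t).1 a, fun b l => (c A t).2 b l) :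
          MinorFamily d q) n m}
    refine StabilizesOn.of_cover (ι := Finset (Fin d) ⊕ C)
      (U := Sum.elim
        (fun A => rankLocus K (n + d * q A) (Function.update (fun A => q A + 1) A (q A)))
        (fun c => rankLocus K n (fun A => q A + 1) ∩ {p | MinorFamily.prod K
          (fun A t => (fun a => (c.1 A t).1 a, fun b l => (c.1 A t).2 b l) : MinorFamily d q) ∉
            p.asIdeal})) ?_ ?_
    · rintro (A | c)
      · refine (ih _ ?_ _ _ rfl).of_le (Nat.le_add_right _ _)
        rw [← hk]
        refine Finset.sum_lt_sum (fun A' _ => ?_) ⟨A, Finset.mem_univ _, ?_⟩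
        · rw [Function.update_apply]
          split_ifs with h
          · rw [h]; exact Nat.le_succ _
          · exact le_rfl
        · rw [Function.update_self]
          exact Nat.lt_succ_self _
      · exact (c.2.stabilizesOn (Nat.succ_pos _) (by omega)).of_le (by omega)
    · intro p hp
      by_cases hA : ∃ A, ∃ S : Finset ℕ, S.card ≤ d * q A ∧
          ∀ (I : Fin (q A) → ℕ) (W : Fin (q A) → Fin d → ℕ), Admissible n A I W →
            (∀ a, I a ∉ S) → (flatMatrix K A I W).det ∈ p.asIdeal
      · obtain ⟨A, S, hS, h⟩ := hA
        obtain ⟨σ, hσ, hmem⟩ := exists_fixesBelow_mem_rankLocus_update hp hS h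
        exact ⟨Sum.inl A, σ, hσ, hmem⟩
      · choose c hc using fun A => (exists_hitting_set_or_disjoint_minors p n A (q A)).resolve_left
          fun h => hA ⟨A, h⟩
        obtain ⟨σ, hσ, c', hc', hmem⟩ := exists_fixesBelow_good (m := m) (by omega)
          (fun A => (hc A).1) (fun A => (hc A).2)
        refine ⟨Sum.inr ⟨fun A t => (fun a => ⟨(c' A t).1 a, hc'.row_lt A t a⟩,
          fun b l => ⟨(c' A t).2 b l, hc'.col_lt A t b l⟩), hc'⟩, σ, hσ,
            stableAbove_rankLocus n _ σ hσ p hp, hmem⟩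

end RankInduction

/-! ### Vanishing of minors on the image of an equivariant map. -/

lemma det_eq_zero_of_factorization {R E : Type*} [CommRing R] [Fintype E] {r : ℕ}
    (hr : r = Fintype.card E + 1) (G : Fin r → E → R) (H : E → Fin r → R)
    {F : Matrix (Fin r) (Fin r) R} (hF : ∀ a b, F a b = ∑ e, G a e * H e b) : F.det = 0 := by
  classical
  -- The extra point `none` pads the factors to square matrices, the left one with a zero column.
  let ε : Option E ≃ Fin r := Fintype.equivFinOfCardEq (by simp [hr])
  let G' : Matrix (Fin r) (Fin r) R := Matrix.of fun a x => (ε.symm x).elim 0 (G a)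
  let H' : Matrix (Fin r) (Fin r) R := Matrix.of fun x b => (ε.symm x).elim 0 (fun e => H e b)
  have : F = G' * H' := by
    ext a b
    rw [Matrix.mul_apply, ← ε.sum_comp, Fintype.sum_option]
    simp [G', H', hF]
  rw [this, Matrix.det_mul, Matrix.det_eq_zero_of_column_eq_zero (ε none), zero_mul]
  intro a
  simp [G']

section Equivariant

variable {K : Type u} [CommRing K] {k d : ℕ}
  {Φ : MvPolynomial (Fin d → ℕ) K →ₐ[K] MvPolynomial (Fin k × ℕ) K}

lemma tensorRingAct_X (σ : Equiv.Perm ℕ) (v : Fin d → ℕ) :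
    tensorRingAct K d σ (MvPolynomial.X v) = MvPolynomial.X fun l => σ (v l) :=
  MvPolynomial.rename_X _ _

/-- Swapping a column not named by `v` with a fresh one fixes `X v`, hence its image, so that column
cannot occur. -/
lemma mem_range_of_mem_vars
    (hΦ : ∀ σ f, Φ (tensorRingAct K d σ f) = matrixRingAct K k σ (Φ f)) {v : Fin d → ℕ}
    {p : Fin k × ℕ} (hp : p ∈ (Φ (MvPolynomial.X v)).vars) : ∃ l, v l = p.2 := by
  classical
  by_contra! hcon
  obtain ⟨c, hc⟩ := Infinite.exists_notMem_finset
    (Finset.univ.image v ∪ (Φ (MvPolynomial.X v)).vars.image Prod.snd)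
  simp only [Finset.mem_union, Finset.mem_image, Finset.mem_univ, true_and, not_or] at hc
  have hfix : tensorRingAct K d (Equiv.swap p.2 c) (MvPolynomial.X v) = MvPolynomial.X v := by
    rw [tensorRingAct_X]
    congr 1
    funext l
    exact Equiv.swap_apply_of_ne_of_ne (hcon l) fun h => hc.1 ⟨l, h⟩
  have h1 := hΦ (Equiv.swap p.2 c) (MvPolynomial.X v)
  rw [hfix] at h1
  rw [h1] at hp
  obtain ⟨x, hx, hxp⟩ := MvPolynomial.mem_vars_rename _ _ hp
  refine hc.2 ⟨x, hx, ?_⟩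
  have h2 : Equiv.swap p.2 c x.2 = p.2 := congrArg Prod.snd hxp
  rw [Equiv.swap_apply_eq_iff, Equiv.swap_apply_left] at h2
  exact h2

/-- Every orbit of `d`-tuples has a representative with entries below `d`. -/
lemma exists_bound_of_perm_invariant (g : (Fin d → ℕ) → ℕ)
    (hg : ∀ (σ : Equiv.Perm ℕ) v, g (fun l => σ (v l)) ≤ g v) : ∃ D, ∀ v, g v ≤ D := by
  refine ⟨Finset.univ.sup fun w : Fin d → Fin d => g fun l => w l, fun v => ?_⟩
  obtain ⟨σ, -, hσ⟩ := exists_fixesBelow_map_lt 0 (Finset.univ.image v)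
  have hlt : ∀ l, σ (v l) < d := fun l => by
    refine (hσ _ (Finset.mem_image_of_mem v (Finset.mem_univ l))).trans_le ?_
    rw [zero_add]
    exact Finset.card_image_le.trans (by simp)
  have h1 := hg σ⁻¹ fun l => σ (v l)
  have h2 : (fun l => σ⁻¹ (σ (v l))) = v := funext fun l => σ.symm_apply_apply _
  rw [h2] at h1
  exact h1.trans (Finset.le_sup (f := fun w : Fin d → Fin d => g fun l => w l)
    (Finset.mem_univ fun l => (⟨σ (v l), hlt l⟩ : Fin d)))

lemma exists_totalDegree_le
    (hΦ : ∀ σ f, Φ (tensorRingAct K d σ f) = matrixRingAct K k σ (Φ f)) :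
    ∃ D, ∀ v : Fin d → ℕ, (Φ (MvPolynomial.X v)).totalDegree ≤ D := by
  refine exists_bound_of_perm_invariant (fun v => (Φ (MvPolynomial.X v)).totalDegree) fun σ v => ?_
  rw [← tensorRingAct_X, hΦ]
  exact MvPolynomial.totalDegree_rename_le _ _

lemma prod_filter_snd_eq {R : Type*} [CommRing R] (m : (Fin k × ℕ) →₀ ℕ) (c : ℕ) (g : Fin k → R) :
    ∏ p ∈ m.support with p.2 = c, g p.1 ^ m p = ∏ j, g j ^ m (j, c) := by
  classical
  rw [Finset.prod_subset (s₂ := Finset.univ.image fun j : Fin k => (j, c)),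
    Finset.prod_image fun _ _ _ _ h => congrArg Prod.fst h]
  · rintro ⟨j, c'⟩ hp
    have hc : c' = c := (Finset.mem_filter.1 hp).2
    exact Finset.mem_image.2 ⟨j, Finset.mem_univ j, by rw [hc]⟩
  · intro p hp hn
    obtain ⟨j, -, rfl⟩ := Finset.mem_image.1 hp
    have : m (j, c) = 0 := by
      by_contra h
      exact hn (Finset.mem_filter.2 ⟨Finsupp.mem_support_iff.2 h, rfl⟩)
    rw [this, pow_zero]

/-- Take the image for a fresh row index `c`, group its monomials by their exponents in column `c`,
and swap `c` with `i`; the other columns come from `w` and do not move. -/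
lemma exists_coordinate_factorization
    (hΦ : ∀ σ f, Φ (tensorRingAct K d σ f) = matrixRingAct K k σ (Φ f)) {D : ℕ}
    (hD : ∀ v : Fin d → ℕ, (Φ (MvPolynomial.X v)).totalDegree ≤ D) (A : Finset (Fin d))
    (w : Fin d → ℕ) :
    ∃ H : (Fin k → Fin (D + 1)) → MvPolynomial (Fin k × ℕ) K, ∀ i, (∀ l ∉ A, w l ≠ i) →
      Φ (MvPolynomial.X (slot A i w)) =
        ∑ e : Fin k → Fin (D + 1), (∏ j, MvPolynomial.X (j, i) ^ (e j : ℕ)) * H e := by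
  classical
  obtain ⟨c, hc⟩ := Infinite.exists_notMem_finset (Finset.univ.image w)
  simp only [Finset.mem_image, Finset.mem_univ, true_and, not_exists] at hc
  set f := Φ (MvPolynomial.X (slot A c w)) with hf
  -- The truncation at `D` is inactive on the support, by the degree bound.
  let ex : ((Fin k × ℕ) →₀ ℕ) → Fin k → Fin (D + 1) := fun m j =>
    ⟨min (m (j, c)) D, Nat.lt_succ_of_le (min_le_right _ _)⟩
  refine ⟨fun e => ∑ m ∈ f.support with ex m = e, MvPolynomial.C (f.coeff m) *
    ∏ p ∈ m.support with p.2 ≠ c, MvPolynomial.X p ^ m p, fun i hi => ?_⟩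
  have hslot : MvPolynomial.X (slot A i w) =
      tensorRingAct K d (Equiv.swap c i) (MvPolynomial.X (slot A c w)) := by
    rw [tensorRingAct_X]
    congr 1
    funext l
    simp only [slot]
    split_ifs with h
    · rw [Equiv.swap_apply_left]
    · rw [Equiv.swap_apply_of_ne_of_ne (hc l) (hi l h)]
  rw [hslot, hΦ, ← hf]
  have hterm : ∀ m ∈ f.support,
      ∏ p ∈ m.support, MvPolynomial.X (R := K) (p.1, Equiv.swap c i p.2) ^ m p =
        (∏ j, MvPolynomial.X (j, i) ^ (ex m j : ℕ)) *
          ∏ p ∈ m.support with p.2 ≠ c, MvPolynomial.X p ^ m p := by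
    intro m hm
    rw [← Finset.prod_filter_mul_prod_filter_not m.support (fun p => p.2 = c)]
    congr 1
    · have hex : ∀ j, (ex m j : ℕ) = m (j, c) := fun j => min_eq_left
        ((m.le_degree (j, c)).trans ((MvPolynomial.le_totalDegree hm).trans (hD _)))
      simp only [hex]
      rw [← prod_filter_snd_eq m c fun j => MvPolynomial.X (R := K) (j, i)]
      refine Finset.prod_congr rfl fun p hp => ?_
      rw [(Finset.mem_filter.1 hp).2, Equiv.swap_apply_left]
    · refine Finset.prod_congr rfl fun p hp => ?_
      obtain ⟨hp, hpc⟩ := Finset.mem_filter.1 hp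
      obtain ⟨l, hl⟩ := mem_range_of_mem_vars hΦ (v := slot A c w)
        ((MvPolynomial.mem_vars_iff_mem_support _).2 ⟨m, hm, hp⟩)
      simp only [slot] at hl
      split_ifs at hl with h
      · exact absurd hl.symm hpc
      · rw [Equiv.swap_apply_of_ne_of_ne hpc (hl ▸ hi l h)]
  have hexpand : matrixRingAct K k (Equiv.swap c i) f = ∑ m ∈ f.support,
      MvPolynomial.C (f.coeff m) *
        ∏ p ∈ m.support, MvPolynomial.X (p.1, Equiv.swap c i p.2) ^ m p := by
    rw [MvPolynomial.aeval_unique (matrixRingAct K k (Equiv.swap c i)), MvPolynomial.aeval_def,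
      MvPolynomial.eval₂_eq]
    simp only [matrixRingAct, Function.comp_apply, MvPolynomial.rename_X,
      MvPolynomial.algebraMap_eq]
  rw [hexpand, ← Finset.sum_fiberwise f.support ex]
  refine Finset.sum_congr rfl fun e _ => ?_
  rw [Finset.mul_sum]
  refine Finset.sum_congr rfl fun m hm => ?_
  obtain ⟨hm', rfl⟩ := Finset.mem_filter.1 hm
  rw [hterm m hm']
  ring

lemma exists_minors_mem_ker
    (hΦ : ∀ σ f, Φ (tensorRingAct K d σ f) = matrixRingAct K k σ (Φ f)) :
    ∃ r : ℕ, ∀ (A : Finset (Fin d)) (I : Fin r → ℕ) (W : Fin r → Fin d → ℕ),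
      Admissible 0 A I W → Φ (flatMatrix K A I W).det = 0 := by
  obtain ⟨D, hD⟩ := exists_totalDegree_le hΦ
  refine ⟨Fintype.card (Fin k → Fin (D + 1)) + 1, fun A I W h => ?_⟩
  choose H hH using fun b => exists_coordinate_factorization hΦ hD A (W b)
  rw [AlgHom.map_det]
  exact det_eq_zero_of_factorization rfl
    (fun a e => ∏ j, MvPolynomial.X (j, I a) ^ (e j : ℕ)) (fun e b => H b e)
    fun a b => hH b (I a) (h.2 a b)

end Equivariant

/-! ### From rank loci to the image closure. -/

section Final

variable {K : Type u} [CommRing K] {k d : ℕ}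

lemma exists_algHom_of_hom (φ : matrixScheme K k ⟶ tensorScheme K d) :
    ∃ Φ : MvPolynomial (Fin d → ℕ) K →ₐ[K] MvPolynomial (Fin k × ℕ) K,
      φ.left = Spec.map (CommRingCat.ofHom Φ.toRingHom) := by
  obtain ⟨F, hF⟩ : ∃ F, Spec.map F = φ.left := Spec.map_surjective _
  have hw := Over.w φ
  rw [← hF] at hw
  dsimp only [Over.mk_hom] at hw
  rw [← Spec.map_comp] at hw
  have hw := Spec.map_injective hw
  refine ⟨{ F.hom with
    commutes' := fun a => ?_ }, ?_⟩
  · have := congrArg (fun g => g.hom a) hw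
    exact this
  · rw [← hF]
    rfl

lemma equivariant_of_isSymEquivariant {φ : matrixScheme K k ⟶ tensorScheme K d}
    (hφ : IsSymEquivariant φ)
    {Φ : MvPolynomial (Fin d → ℕ) K →ₐ[K] MvPolynomial (Fin k × ℕ) K}
    (hΦ : φ.left = Spec.map (CommRingCat.ofHom Φ.toRingHom)) (σ : Equiv.Perm ℕ)
    (f : MvPolynomial (Fin d → ℕ) K) :
    Φ (tensorRingAct K d σ f) = matrixRingAct K k σ (Φ f) := by
  have h := congrArg Over.Hom.left (hφ σ⁻¹)
  rw [Over.comp_left, Over.comp_left, hΦ] at h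
  change Spec.map (CommRingCat.ofHom (matrixRingAct K k σ⁻¹⁻¹).toRingHom) ≫ Spec.map _ =
    Spec.map _ ≫ Spec.map (CommRingCat.ofHom (tensorRingAct K d σ⁻¹⁻¹).toRingHom) at h
  rw [← Spec.map_comp, ← Spec.map_comp, inv_inv] at h
  exact (congrArg (fun g => g.hom f) (Spec.map_injective h)).symm

lemma imageClosure_eq_zeroLocus_ker {φ : matrixScheme K k ⟶ tensorScheme K d}
    {Φ : MvPolynomial (Fin d → ℕ) K →ₐ[K] MvPolynomial (Fin k × ℕ) K}
    (hΦ : φ.left = Spec.map (CommRingCat.ofHom Φ.toRingHom)) :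
    imageClosure φ = PrimeSpectrum.zeroLocus (RingHom.ker Φ.toRingHom) := by
  rw [imageClosure, hΦ]
  exact PrimeSpectrum.closure_range_comap _

lemma mem_commonZeros_orbits {F : Set (MvPolynomial (Fin d → ℕ) K)}
    {p : PrimeSpectrum (MvPolynomial (Fin d → ℕ) K)} :
    p ∈ commonZeros (⋃ f ∈ F, symOrbit f) ↔ ∀ f ∈ F, ∀ σ, tensorRingAct K d σ f ∈ p.asIdeal := by
  rw [commonZeros]
  refine (PrimeSpectrum.mem_zeroLocus _ _).trans ?_
  simp only [symOrbit, Set.iUnion_subset_iff, Set.range_subset_iff, SetLike.mem_coe]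

lemma isTopSymNoetherian_of_stabilizesOn {Z Y : Set (PrimeSpectrum (MvPolynomial (Fin d → ℕ) K))}
    (hY : StabilizesOn 0 Y) (hZ : Z ⊆ Y) : IsTopSymNoetherian (K := K) (d := d) Z := by
  intro X hcl hst hsub hanti
  obtain ⟨N, hN⟩ := hY X hcl (fun i σ _ p hp => by
    have := hst i σ⁻¹ hp
    simp only [tensorAct, inv_inv] at this
    exact this) hanti
  exact ⟨N, fun n hn => (hanti hn).antisymm fun p hp => hN n hn ⟨hp, hZ (hsub N hp)⟩⟩

/-- Otherwise adding elements of `I` one at a time would cut the common zeros within `Y` down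
strictly forever. -/
lemma exists_finite_orbits_zeros_subset {Y : Set (PrimeSpectrum (MvPolynomial (Fin d → ℕ) K))}
    (hY : StabilizesOn 0 Y) (I : Ideal (MvPolynomial (Fin d → ℕ) K)) :
    ∃ E : Finset (MvPolynomial (Fin d → ℕ) K), ↑E ⊆ (I : Set (MvPolynomial (Fin d → ℕ) K)) ∧
      commonZeros (⋃ f ∈ (E : Set (MvPolynomial (Fin d → ℕ) K)), symOrbit f) ∩ Y ⊆
        PrimeSpectrum.zeroLocus I := by
  classical
  by_contra! hcon
  let R := MvPolynomial (Fin d → ℕ) K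
  let T := {E : Finset R // ↑E ⊆ (I : Set R)}
  have hstep : ∀ E : T,
      ∃ E' : T,
        E.1 ⊆ E'.1 ∧ ∃ p ∈ Y, p ∈ commonZeros (⋃ f ∈ (E.1 : Set R), symOrbit f) ∧
          p ∉ commonZeros (⋃ f ∈ (E'.1 : Set R), symOrbit f) := by
    intro E
    obtain ⟨p, hp, hpI⟩ := Set.not_subset.1 (hcon E.1 E.2)
    obtain ⟨f, hf, hfp⟩ := Set.not_subset.1 hpI
    refine ⟨⟨insert f E.1, ?_⟩, Finset.subset_insert _ _, p, hp.2, hp.1, fun h => hfp ?_⟩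
    · rw [Finset.coe_insert]
      exact Set.insert_subset hf E.2
    · have := mem_commonZeros_orbits.1 h f (Finset.mem_insert_self f E.1) 1
      rwa [tensorRingAct_one] at this
  choose next hsub p hpY hp hp' using hstep
  let E : ℕ → T := fun n =>
    Nat.rec ⟨∅, by simp⟩ (fun _ E => next E) n
  have hmono : Monotone fun n => (E n).1 := monotone_nat_of_le_succ fun n => hsub (E n)
  obtain ⟨N, hN⟩ := hY (fun n => commonZeros (⋃ f ∈ ((E n).1 : Set R), symOrbit f))
    (fun n => PrimeSpectrum.isClosed_zeroLocus _)
    (fun n σ _ q hq => mem_commonZeros_orbits.2 fun f hf τ => by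
      rw [mem_tensorComap, ← tensorRingAct_mul]
      exact mem_commonZeros_orbits.1 hq f hf _)
    (fun a b hab q hq => mem_commonZeros_orbits.2 fun f hf =>
      mem_commonZeros_orbits.1 hq f (hmono hab hf))
  exact hp' (E N) (hN (N + 1) (Nat.le_succ N) ⟨hp (E N), hpY (E N)⟩)

/-- A minor involves at most `r + r * d` indices, so up to a permutation all of them lie below this
bound. -/
lemma exists_finite_orbits_zeros_subset_rankLocus (r : ℕ) :
    ∃ F : Set (MvPolynomial (Fin d → ℕ) K), F.Finite ∧
      (∀ f ∈ F, ∃ (A : Finset (Fin d)) (I : Fin r → ℕ) (W : Fin r → Fin d → ℕ),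
        Admissible 0 A I W ∧ f = (flatMatrix K A I W).det) ∧
      commonZeros (⋃ f ∈ F, symOrbit f) ⊆ rankLocus K 0 fun _ : Finset (Fin d) => r := by
  let m := Fintype.card (Fin r ⊕ Fin r × Fin d)
  let D : Finset (Fin d) × (Fin r → Fin m) × (Fin r → Fin d → Fin m) →
      MvPolynomial (Fin d → ℕ) K := fun x =>
    (flatMatrix K x.1 (fun a => (x.2.1 a : ℕ)) fun b l => (x.2.2 b l : ℕ)).det
  refine ⟨D '' {x | Admissible 0 x.1 (fun a => (x.2.1 a : ℕ)) fun b l => (x.2.2 b l : ℕ)},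
    Set.toFinite _, ?_, fun p hp A I W h => ?_⟩
  · rintro _ ⟨x, hx, rfl⟩
    exact ⟨_, _, _, hx, rfl⟩
  · let G : Fin r ⊕ Fin r × Fin d → ℕ := Sum.elim I fun y => W y.1 y.2
    obtain ⟨σ, -, hlt⟩ := exists_fixesBelow_map_lt 0 (Finset.univ.image G)
    have hG : ∀ x, σ (G x) < m := fun x =>
      (hlt _ (Finset.mem_image_of_mem G (Finset.mem_univ x))).trans_le
        ((zero_add _).le.trans Finset.card_image_le)
    have := mem_commonZeros_orbits.1 hp _ ⟨(A, fun a => ⟨σ (I a), hG (Sum.inl a)⟩,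
      fun b l => ⟨σ (W b l), hG (Sum.inr (b, l))⟩),
      ⟨fun a => Nat.zero_le _, fun a b l hl => σ.injective.ne (h.2 a b l hl)⟩, rfl⟩ σ⁻¹
    rw [map_det_flatMatrix] at this
    have hinv : ∀ x, σ⁻¹ (σ x) = x := σ.symm_apply_apply
    simp only [hinv] at this
    exact this

end Final

theorem mainTheorem2 (K : Type u) [CommRing K] [IsNoetherianRing K] (k d : ℕ)
    (φ : matrixScheme K k ⟶ tensorScheme K d) (hφ : IsSymEquivariant φ) :
    (∃ F : Set (MvPolynomial (Fin d → ℕ) K), F.Finite ∧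
      imageClosure φ = commonZeros (⋃ f ∈ F, symOrbit f)) ∧
    IsTopSymNoetherian (imageClosure φ) := by
  obtain ⟨Φ, hΦ⟩ := exists_algHom_of_hom φ
  have hequiv := equivariant_of_isSymEquivariant hφ hΦ
  obtain ⟨r, hr⟩ := exists_minors_mem_ker hequiv
  have hstab := stabilizesOn_rankLocus (K := K) 0 fun _ : Finset (Fin d) => r
  have hC := imageClosure_eq_zeroLocus_ker hΦ
  have hker : ∀ f, f ∈ RingHom.ker Φ.toRingHom ↔ Φ f = 0 := fun f => Iff.rfl
  have hsub : PrimeSpectrum.zeroLocus (RingHom.ker Φ.toRingHom) ⊆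
      rankLocus K 0 fun _ : Finset (Fin d) => r :=
    fun p hp A I W h => hp ((hker _).2 (hr A I W h))
  constructor
  · obtain ⟨E, hE, hEsub⟩ := exists_finite_orbits_zeros_subset hstab (RingHom.ker Φ.toRingHom)
    obtain ⟨F, hF, hFdet, hFsub⟩ := exists_finite_orbits_zeros_subset_rankLocus (K := K) (d := d) r
    -- The equations `E` cut out the closure only inside the rank locus, which `F` enforces.
    refine ⟨F ∪ E, hF.union E.finite_toSet, ?_⟩
    rw [hC]
    refine Set.Subset.antisymm (fun p hp => mem_commonZeros_orbits.2 fun f hf σ => hp ?_)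
      fun p hp => ?_
    · refine (hker _).2 ?_
      rw [hequiv]
      have hf0 : Φ f = 0 := by
        rcases hf with hf | hf
        · obtain ⟨A, I, W, h, rfl⟩ := hFdet f hf
          exact hr A I W h
        · exact (hker _).1 (hE hf)
      rw [hf0, map_zero]
    · have hp := mem_commonZeros_orbits.1 hp
      exact hEsub ⟨mem_commonZeros_orbits.2 fun f hf => hp f (Or.inr hf),
        hFsub (mem_commonZeros_orbits.2 fun f hf => hp f (Or.inl hf))⟩
  · rw [hC]
    exact isTopSymNoetherian_of_stabilizesOn hstab hsub
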